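/- **Setting.** Let $n\ge 2$, $\delta\in(0,1]$, $\sigma\ge 0$ and $\theta=(\theta_1,\dots,\theta_n)\in\mathbb R^n$. Observations are $y_t=\theta_t+Z_t$, $t=1,\dots,n$, where $Z_1,\dots,Z_n$ are independent and $\sigma$-subgaussian, i.e. $\mathbb E\,e^{\lambda Z_t}\le e^{\lambda^2\sigma^2/2}$ for all $\lambda\in\mathbb R$ (in particular they have mean zero). In round $t$ a forecaster predicts $x_t$ from $y_1,\dots,y_{t-1}$ only. Write $D\theta=(\theta_2-\theta_1,\dots,\theta_n-\theta_{n-1})$ and $\bar y_{a:t}=\frac1{t-a+1}\sum_{s=a}^t y_s$. **The ARROWS policy** with inputs $n$, $\sigma$, $\beta$. Put $y_0=0$ and start a new bin at $t_h=1$. For $t=1,\dots,n$: if a new bin starts in round $t$ (i.e. $t_h=t$), predict $x_t=y_{t-1}$, otherwise predict $x_t=\bar y_{t_h:t-1}$. Then observe $y_t$. Let $\tilde y\in\mathbb R^k$ be the vector $(y_{t_h}-\bar y_{t_h:t},\dots,y_t-\bar y_{t_h:t})$, padded with zeros at the end up to the least power of two $k\ge t-t_h+1$. Let $H$ be the orthogonal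 $k\times k$ discrete Haar wavelet transform matrix, and let $\hat\alpha$ be the result of soft-thresholding $H\tilde y$ entrywise at level $\sigma\sqrt{\beta\log n}$. For $0\le l<\log_2 k$ let $\hat\alpha[l]$ be the block of the $2^l$ entries of $\hat\alpha$ that belong to the Haar wavelets of level $l$. If $$\frac1{\sqrt k}\sum_{l=0}^{\log_2 k-1}2^{l/2}\,\|\hat\alpha[l]\|_1>\frac{\sigma}{\sqrt k},$$ a new bin starts in round $t+1$, i.e. $t_h$ is set to $t+1$. The policy uses neither $\theta$ nor any bound on $\|D\theta\|_1$. **Theorem.** There are universal constants $C>0$ and $k_0\in\mathbb N$ such that for all $n,\delta,\sigma,\theta$ and all noise variables as above, the ARROWS policy with $\beta=24+\frac{8\log(8/\delta)}{\log n}$ satisfies, with probability at least $1-\delta$, $$\sum_{t=1}^n (x_t-\theta_t)^2\;\le\; C\,\bigl(1+\log n+\log(1/\delta)\bigr)^{k_0}\Bigl(n^{1/3}\|D\theta\|_1^{2/3}\sigma^{4/3}+|\theta_1|^2+\|D\theta\|_2^2+\sigma^2\Bigr).$$ -/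

import Mathlib

open MeasureTheory ProbabilityTheory
open scoped NNReal Matrix

noncomputable section

namespace Arrows

/-- A forecasting strategy: before round `i + 1` the player has seen the `i` observations
`y_1, …, y_i` and plays a real number that is a function of these only. -/
def Strategy : Type := (i : ℕ) → (Fin i → ℝ) → ℝ

/-- The cumulative squared error `∑ (x_t - θ_t)²` of a strategy on the truth `θ` when the
observations are `y`. Rounds are indexed by `Fin n`, so that `θ_1` is `θ 0`. -/
def cumulativeError {n : ℕ} (A : Strategy) (θ y : Fin n → ℝ) : ℝ :=
  ∑ t : Fin n, (A t (fun s : Fin t => y ⟨s, s.isLt.trans t.isLt⟩) - θ t) ^ 2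

/-- The discrete difference operator `Dθ = (θ_2 - θ_1, …, θ_n - θ_{n-1})`. -/
def diff {n : ℕ} (θ : Fin n → ℝ) (i : Fin (n - 1)) : ℝ :=
  θ ⟨i + 1, by omega⟩ - θ ⟨i, by omega⟩

/-- Soft thresholding at level `lam`. -/
def softThreshold (lam x : ℝ) : ℝ := Real.sign x * max (|x| - lam) 0

/-- The orthogonal discrete Haar wavelet transform matrix of size `2 ^ m`. Row `0` is constant.
Row `2 ^ l + i` with `l < m`, `i < 2 ^ l` is the `i`-th Haar wavelet of level `l`: it is supported
on the dyadic block `[i * w, (i + 1) * w)` of width `w = 2 ^ (m - l)`, is `-1 / √w` on the first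
half of the block and `1 / √w` on the second half. -/
def haarMatrix (m : ℕ) : Matrix (Fin (2 ^ m)) (Fin (2 ^ m)) ℝ :=
  Matrix.of fun j s =>
    if j.val = 0 then 1 / √((2 : ℝ) ^ m)
    else
      let l := Nat.log 2 j.val
      let i := j.val - 2 ^ l
      let w := 2 ^ (m - l)
      if i * w ≤ s.val ∧ s.val < i * w + w / 2 then -(1 / √(w : ℝ))
      else if i * w + w / 2 ≤ s.val ∧ s.val < (i + 1) * w then 1 / √(w : ℝ)
      else 0

/-- The `ℓ¹` norm of the block `α[l]` of level-`l` coefficients: it consists of the `2 ^ l`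
entries of `α` at the positions `2 ^ l, …, 2 ^ (l + 1) - 1`, counted from `0`. -/
def blockNorm {m : ℕ} (α : Fin (2 ^ m) → ℝ) (l : ℕ) : ℝ :=
  ∑ j : Fin (2 ^ m) with 2 ^ l ≤ j.val ∧ j.val < 2 ^ (l + 1), |α j|

/-- The average of `y_a, …, y_t`. -/
def mean (y : ℕ → ℝ) (a t : ℕ) : ℝ := (∑ s ∈ Finset.Icc a t, y s) / ((t + 1 - a : ℕ) : ℝ)

/-- The padded length of the segment `y_a, …, y_t` is `2 ^ padExp a t`, the least power of two
that is at least the length of the segment. -/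
def padExp (a t : ℕ) : ℕ := Nat.clog 2 (t + 1 - a)

/-- The recentred segment `y_a, …, y_t`, padded with zeros at the end. -/
def pad (y : ℕ → ℝ) (a t : ℕ) (j : Fin (2 ^ padExp a t)) : ℝ :=
  if a + j.val ≤ t then y (a + j.val) - mean y a t else 0

/-- The soft-thresholded Haar coefficients of the segment `y_a, …, y_t`. -/
def thresholdedCoeffs (lam : ℝ) (y : ℕ → ℝ) (a t : ℕ) (j : Fin (2 ^ padExp a t)) : ℝ :=
  softThreshold lam ((haarMatrix (padExp a t) *ᵥ pad y a t) j)

/-- The restart rule, evaluated on the current bin `y_a, …, y_t`. -/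
def Restart (σ lam : ℝ) (y : ℕ → ℝ) (a t : ℕ) : Prop :=
  σ / √((2 : ℝ) ^ padExp a t) <
    1 / √((2 : ℝ) ^ padExp a t) *
      ∑ l ∈ Finset.range (padExp a t),
        (2 : ℝ) ^ ((l : ℝ) / 2) * blockNorm (thresholdedCoeffs lam y a t) l

open Classical in
/-- The value of the start time `t_h` of the current bin after round `t` has been processed.
Rounds are counted from `1`; a new bin is to be opened in round `t + 1` if and only if this value
is `t + 1`. -/
def binStart (σ lam : ℝ) (y : ℕ → ℝ) : ℕ → ℕ
  | 0 => 1
  | t + 1 =>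
    if Restart σ lam y (binStart σ lam y t) (t + 1) then t + 2 else binStart σ lam y t

/-- The prediction for round `t + 1`, from `y_1, …, y_t` (with the convention `y_0 = 0`): the last
observation if a new bin opens, and else the average of the observations in the current bin. -/
def predict (σ lam : ℝ) (y : ℕ → ℝ) (t : ℕ) : ℝ :=
  if binStart σ lam y t = t + 1 then y t else mean y (binStart σ lam y t) t

/-- Past observations `y_1, …, y_i` as a sequence on `ℕ` with `y_0 = 0`. -/
def extendZero {i : ℕ} (past : Fin i → ℝ) (s : ℕ) : ℝ :=
  if h : 1 ≤ s ∧ s ≤ i then past ⟨s - 1, by omega⟩ else 0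

/-- The ARROWS policy with time horizon `n`, noise parameter `σ` and hyper-parameter `β`; its
threshold is `σ √(β log n)`. -/
def policy (n : ℕ) (σ β : ℝ) : Strategy := fun i past =>
  predict σ (σ * √(β * Real.log n)) (extendZero past) i

end Arrows

end

/-!
Every Haar coefficient of a segment and its normalized sum are linear functionals of norm at most
`1`. There are at most `n²` segments with at most `2 n` such functionals each, so with probability
at least `1 - δ` they are all at most `λ / 2` on the noise, where `λ = σ √(β log n)`. On this event
the argument is deterministic.

* A restart forces some Haar coefficient of `θ` on the closed bin to exceed `λ / 2`. As this
  coefficient is at most `√(2 L)` times the total variation `V` of `θ` on the bin of length `L`,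
  the cost `λ²` of the noise in the bin is at most twice its minimax rate `λ^(4/3) L^(1/3) V^(2/3)`.
* While there is no restart, all Haar coefficients of `θ` on the bin are at most `3 λ`. Each of the
  logarithmically many levels then has energy at most a constant times the rate, so the scatter of
  `θ` on the bin is small, and the scatter controls the errors of the running averages.
* By Hölder's inequality the rates of consecutive bins add up to at most the rate of their union,
  which bounds the total error whatever the number of bins is.
-/

noncomputable section

namespace Arrows

section Haar

/-- The total variation `∑ |g (u + 1) - g u|` of a sequence on the integer interval `[a, b]`. -/
def variation (g : ℕ → ℝ) (a b : ℕ) : ℝ := ∑ u ∈ Finset.Ico a b, |g (u + 1) - g u|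

/-- The sum of a sequence over its `i`-th block of width `w`, counted from `0`. -/
def blockSum (w : ℕ) (g : ℕ → ℝ) (i : ℕ) : ℝ := ∑ u ∈ Finset.range w, g (i * w + u)

/-- The energy of the projection of the first `N` blocks of width `w` of a sequence to the
functions that are constant on each block. -/
def blockEnergy (N w : ℕ) (g : ℕ → ℝ) : ℝ := ∑ i ∈ Finset.range N, blockSum w g i ^ 2 / w

/-- The inner product of a sequence with the `i`-th Haar wavelet of half-width `w`, which is
`-1 / √(2 * w)` on the block `2 * i` of width `w` and `1 / √(2 * w)` on the block `2 * i + 1`. -/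
def haarCoeff (w : ℕ) (g : ℕ → ℝ) (i : ℕ) : ℝ :=
  (blockSum w g (2 * i + 1) - blockSum w g (2 * i)) / √(2 * w)

variable (g : ℕ → ℝ) (w N : ℕ)

theorem variation_nonneg (a b : ℕ) : 0 ≤ variation g a b :=
  Finset.sum_nonneg fun _ _ => abs_nonneg _

theorem variation_mono {a b c d : ℕ} (hab : a ≤ b) (hcd : c ≤ d) :
    variation g b c ≤ variation g a d :=
  Finset.sum_le_sum_of_subset_of_nonneg (Finset.Ico_subset_Ico hab hcd) fun _ _ _ => abs_nonneg _

theorem variation_add_variation {a b c : ℕ} (hab : a ≤ b) (hbc : b ≤ c) :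
    variation g a b + variation g b c = variation g a c :=
  Finset.sum_Ico_consecutive _ hab hbc

theorem variation_add_variation_le {a b c d : ℕ} (hac : a ≤ c) (hbc : b ≤ c) (hbd : b ≤ d) :
    variation g a b + variation g c d ≤ variation g a d := by
  have hdisj : Disjoint (Finset.Ico a b) (Finset.Ico c d) := by
    rw [Finset.disjoint_left]
    intro u
    simp only [Finset.mem_Ico]
    omega
  rw [variation, variation, ← Finset.sum_union hdisj]
  exact Finset.sum_le_sum_of_subset_of_nonneg
    (Finset.union_subset (Finset.Ico_subset_Ico le_rfl hbd) (Finset.Ico_subset_Ico hac le_rfl))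
    fun _ _ _ => abs_nonneg _

theorem abs_sub_le_variation {a b : ℕ} (hab : a ≤ b) : |g b - g a| ≤ variation g a b := by
  rw [← Finset.sum_Ico_sub g hab]
  exact Finset.abs_sum_le_sum_abs _ _

theorem sum_variation_blocks :
    ∑ i ∈ Finset.range N, variation g (i * w) ((i + 1) * w) = variation g 0 (N * w) := by
  induction N with
  | zero => simp [variation]
  | succ N ih =>
    rw [Finset.sum_range_succ, ih,
      variation_add_variation g (Nat.zero_le _) (Nat.mul_le_mul_right w N.le_succ)]

theorem blockSum_two_mul (i : ℕ) :
    blockSum (2 * w) g i = blockSum w g (2 * i) + blockSum w g (2 * i + 1) := by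
  unfold blockSum
  rw [two_mul w, Finset.sum_range_add]
  congr! 3 <;> ring

theorem blockEnergy_two_mul {w : ℕ} (hw : 0 < w) :
    blockEnergy (2 * N) w g =
      blockEnergy N (2 * w) g + ∑ i ∈ Finset.range N, haarCoeff w g i ^ 2 := by
  have hpair : ∀ i, blockSum w g (2 * i) ^ 2 / w + blockSum w g (2 * i + 1) ^ 2 / w =
      blockSum (2 * w) g i ^ 2 / (2 * w : ℕ) + haarCoeff w g i ^ 2 := by
    intro i
    rw [blockSum_two_mul, haarCoeff, div_pow, Real.sq_sqrt (by positivity)]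
    push_cast
    field_simp
    ring
  unfold blockEnergy
  rw [← Finset.sum_add_distrib, ← Finset.sum_congr rfl fun i _ => hpair i]
  induction N with
  | zero => simp
  | succ N ih =>
    rw [Nat.mul_succ, Finset.sum_range_succ, Finset.sum_range_succ, ih, Finset.sum_range_succ,
      add_assoc]

theorem sum_haarCoeff_sq_of_sum_eq_zero (m : ℕ) (hg : ∑ s ∈ Finset.range (2 ^ m), g s = 0) :
    ∑ l ∈ Finset.range m, ∑ i ∈ Finset.range (2 ^ l), haarCoeff (2 ^ (m - 1 - l)) g i ^ 2 =
      ∑ s ∈ Finset.range (2 ^ m), g s ^ 2 := by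
  have energy_eq : ∀ k ≤ m, blockEnergy (2 ^ k) (2 ^ (m - k)) g =
      ∑ l ∈ Finset.range k, ∑ i ∈ Finset.range (2 ^ l), haarCoeff (2 ^ (m - 1 - l)) g i ^ 2 := by
    intro k hk
    induction k with
    | zero => simp [blockEnergy, blockSum, hg]
    | succ k ih =>
      rw [Finset.sum_range_succ, ← ih (by omega), show m - (k + 1) = m - 1 - k by omega,
        show m - k = m - 1 - k + 1 by omega, pow_succ' 2 k, pow_succ' 2 (m - 1 - k),
        blockEnergy_two_mul g _ (by positivity)]
  rw [← energy_eq m le_rfl]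
  simp [blockEnergy, blockSum]

theorem abs_haarCoeff_le (i : ℕ) :
    |haarCoeff w g i| ≤ √(2 * w) / 2 * variation g (i * (2 * w)) ((i + 1) * (2 * w)) := by
  set V := variation g (i * (2 * w)) ((i + 1) * (2 * w)) with hV
  have hdiff : |blockSum w g (2 * i + 1) - blockSum w g (2 * i)| ≤ w * V := by
    unfold blockSum
    rw [← Finset.sum_sub_distrib]
    refine (Finset.abs_sum_le_sum_abs _ _).trans
      ((Finset.sum_le_card_nsmul _ _ V fun u hu => ?_).trans_eq (by simp))
    have hu : u < w := Finset.mem_range.mp hu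
    refine (abs_sub_le_variation g (by gcongr; omega)).trans (variation_mono g ?_ ?_) <;> linarith
  rcases w.eq_zero_or_pos with rfl | hw
  · simp [haarCoeff]
  have hsqrt : √(2 * w : ℝ) * √(2 * w) = 2 * w := Real.mul_self_sqrt (by positivity)
  rw [haarCoeff, abs_div, abs_of_nonneg (Real.sqrt_nonneg _), div_le_iff₀ (by positivity)]
  exact hdiff.trans_eq (by linear_combination -(V / 2) * hsqrt)

theorem sum_abs_haarCoeff_le :
    ∑ i ∈ Finset.range N, |haarCoeff w g i| ≤ √(2 * w) / 2 * variation g 0 (N * (2 * w)) := by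
  rw [← sum_variation_blocks, Finset.mul_sum]
  exact Finset.sum_le_sum fun i _ => abs_haarCoeff_le g w i

theorem sum_fin_ite_block {M w k : ℕ} (hk : (k + 1) * w ≤ M) :
    ∑ s : Fin M, (if k * w ≤ s ∧ s < (k + 1) * w then g s else 0) = blockSum w g k := by
  rw [Fin.sum_univ_eq_sum_range fun s => if k * w ≤ s ∧ s < (k + 1) * w then g s else 0,
    ← Finset.sum_filter, blockSum]
  have hblock : (Finset.range M).filter (fun s => k * w ≤ s ∧ s < (k + 1) * w) =
      Finset.Ico (k * w) ((k + 1) * w) := by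
    ext s
    simp only [Finset.mem_filter, Finset.mem_range, Finset.mem_Ico]
    omega
  rw [hblock, Finset.sum_Ico_eq_sum_range, add_one_mul, Nat.add_sub_cancel_left]

theorem haarMatrix_apply {m l i : ℕ} (j s : Fin (2 ^ m)) (hj : (j : ℕ) = 2 ^ l + i)
    (hi : i < 2 ^ l) :
    haarMatrix m j s =
      ((if (2 * i + 1) * 2 ^ (m - 1 - l) ≤ s ∧ s < (2 * i + 1 + 1) * 2 ^ (m - 1 - l) then 1 else 0)
        - (if 2 * i * 2 ^ (m - 1 - l) ≤ s ∧ s < (2 * i + 1) * 2 ^ (m - 1 - l) then 1 else 0)) /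
        √(2 * (2 ^ (m - 1 - l) : ℕ)) := by
  have hlog : Nat.log 2 j = l := Nat.log_eq_of_pow_le_of_lt_pow (by omega) (by rw [pow_succ]; omega)
  have hlm : l < m := (Nat.pow_lt_pow_iff_right one_lt_two).mp (by have := j.isLt; omega)
  have hwidth : 2 ^ (m - l) = 2 * 2 ^ (m - 1 - l) := by
    rw [← pow_succ', show m - 1 - l + 1 = m - l by omega]
  have : 0 < 2 ^ l := by positivity
  simp only [haarMatrix, Matrix.of_apply, hlog, hwidth, Nat.mul_div_cancel_left _ two_pos,
    show (j : ℕ) ≠ 0 by omega, if_false, show (j : ℕ) - 2 ^ l = i by omega]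
  generalize 2 ^ (m - 1 - l) = w
  rw [show i * (2 * w) = 2 * i * w by ring, show (i + 1) * (2 * w) = 2 * i * w + 2 * w by ring,
    show (2 * i + 1 + 1) * w = 2 * i * w + 2 * w by ring, add_one_mul]
  push_cast
  split_ifs <;> first | omega | ring

theorem haarMatrix_mulVec {m l i : ℕ} (j : Fin (2 ^ m)) (hj : (j : ℕ) = 2 ^ l + i)
    (hi : i < 2 ^ l) :
    (haarMatrix m *ᵥ fun s => g s) j = haarCoeff (2 ^ (m - 1 - l)) g i := by
  have hlm : l < m := (Nat.pow_lt_pow_iff_right one_lt_two).mp (by have := j.isLt; omega)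
  have hfit : (2 * i + 1 + 1) * 2 ^ (m - 1 - l) ≤ 2 ^ m :=
    calc (2 * i + 1 + 1) * 2 ^ (m - 1 - l) = (i + 1) * 2 ^ (m - 1 - l + 1) := by ring
      _ ≤ 2 ^ l * 2 ^ (m - 1 - l + 1) := Nat.mul_le_mul_right _ hi
      _ = 2 ^ m := by rw [← pow_add]; congr 1; omega
  rw [haarCoeff, ← sum_fin_ite_block g hfit,
    ← sum_fin_ite_block g ((Nat.mul_le_mul_right _ (Nat.le_succ _)).trans hfit),
    ← Finset.sum_sub_distrib, Finset.sum_div]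
  change ∑ s, haarMatrix m j s * g s = _
  refine Finset.sum_congr rfl fun s _ => ?_
  rw [haarMatrix_apply j s hj hi, div_mul_eq_mul_div, sub_mul, ite_mul, ite_mul, one_mul, zero_mul]

end Haar

section Scatter

/-- The sum of squared deviations of `θ_a, …, θ_t` from their mean. -/
def scatter (θ : ℕ → ℝ) (a t : ℕ) : ℝ := ∑ s ∈ Finset.Icc a t, (θ s - mean θ a t) ^ 2

variable (θ : ℕ → ℝ) (a t : ℕ)

theorem isLinearMap_mean : IsLinearMap ℝ fun y => mean y a t where
  map_add y z := by simp only [mean, Pi.add_apply, Finset.sum_add_distrib, add_div]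
  map_smul r y := by simp only [mean, Pi.smul_apply, smul_eq_mul, ← Finset.mul_sum, mul_div_assoc]

theorem length_mul_mean : ((t + 1 - a : ℕ) : ℝ) * mean θ a t = ∑ s ∈ Finset.Icc a t, θ s := by
  rcases Nat.eq_zero_or_pos (t + 1 - a) with h | h
  · rw [h, Nat.cast_zero, zero_mul, Finset.Icc_eq_empty (by omega), Finset.sum_empty]
  · rw [mean, mul_div_cancel₀ _ (by positivity)]

theorem sum_sub_mean : ∑ s ∈ Finset.Icc a t, (θ s - mean θ a t) = 0 := by
  rw [Finset.sum_sub_distrib, Finset.sum_const, Nat.card_Icc, nsmul_eq_mul, length_mul_mean,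
    sub_self]

theorem scatter_nonneg : 0 ≤ scatter θ a t :=
  Finset.sum_nonneg fun _ _ => sq_nonneg _

theorem scatter_add_length_mul_sq_mean :
    scatter θ a t + ((t + 1 - a : ℕ) : ℝ) * mean θ a t ^ 2 = ∑ s ∈ Finset.Icc a t, θ s ^ 2 := by
  have hsq : ∀ s, θ s ^ 2 =
      (θ s - mean θ a t) ^ 2 + 2 * mean θ a t * (θ s - mean θ a t) + mean θ a t ^ 2 :=
    fun s => by ring
  simp only [hsq, Finset.sum_add_distrib, ← Finset.mul_sum, sum_sub_mean, Finset.sum_const,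
    Nat.card_Icc, nsmul_eq_mul, mul_zero, add_zero, scatter]

variable {a t}

theorem abs_last_sub_mean_le_variation (h : a ≤ t) : |θ t - mean θ a t| ≤ variation θ a t := by
  have hL : (0 : ℝ) < (t + 1 - a : ℕ) := by norm_cast; omega
  have hsum : ((t + 1 - a : ℕ) : ℝ) * (θ t - mean θ a t) = ∑ s ∈ Finset.Icc a t, (θ t - θ s) := by
    rw [mul_sub, length_mul_mean, Finset.sum_sub_distrib, Finset.sum_const, nsmul_eq_mul,
      Nat.card_Icc]
  refine le_of_mul_le_mul_left ?_ hL
  calc ((t + 1 - a : ℕ) : ℝ) * |θ t - mean θ a t| = |∑ s ∈ Finset.Icc a t, (θ t - θ s)| := by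
        rw [← hsum, abs_mul, abs_of_pos hL]
    _ ≤ ∑ s ∈ Finset.Icc a t, |θ t - θ s| := Finset.abs_sum_le_sum_abs _ _
    _ ≤ ∑ _s ∈ Finset.Icc a t, variation θ a t := Finset.sum_le_sum fun s hs =>
        (abs_sub_le_variation θ (Finset.mem_Icc.mp hs).2).trans
          (variation_mono θ (Finset.mem_Icc.mp hs).1 le_rfl)
    _ = ((t + 1 - a : ℕ) : ℝ) * variation θ a t := by simp

theorem scatter_succ (h : a ≤ t) :
    scatter θ a (t + 1) = scatter θ a t +
      ((t + 1 - a : ℕ) : ℝ) / ((t + 1 - a : ℕ) + 1) * (mean θ a t - θ (t + 1)) ^ 2 := by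
  have hlen : ((t + 1 + 1 - a : ℕ) : ℝ) = ((t + 1 - a : ℕ) : ℝ) + 1 := by norm_cast; omega
  have hsum := Finset.sum_Icc_succ_top (Nat.le_succ_of_le h) θ
  have hsum_sq := Finset.sum_Icc_succ_top (Nat.le_succ_of_le h) fun s => θ s ^ 2
  rw [← length_mul_mean, ← length_mul_mean, hlen] at hsum
  rw [← scatter_add_length_mul_sq_mean, ← scatter_add_length_mul_sq_mean, hlen] at hsum_sq
  set L := ((t + 1 - a : ℕ) : ℝ)
  have hL : 0 < L + 1 := by positivity
  have hmean : mean θ a (t + 1) = (L * mean θ a t + θ (t + 1)) / (L + 1) := by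
    rw [eq_div_iff hL.ne', mul_comm, hsum]
  rw [hmean] at hsum_sq
  rw [eq_sub_of_add_eq hsum_sq]
  field_simp
  ring

theorem sum_sq_mean_sub_succ_le_scatter (h : a ≤ t) :
    ∑ s ∈ Finset.Ico a t, (mean θ a s - θ (s + 1)) ^ 2 ≤ 2 * scatter θ a t := by
  induction t, h using Nat.le_induction with
  | base => simpa using scatter_nonneg θ a a
  | succ t hat ih =>
    have hL : (1 : ℝ) ≤ (t + 1 - a : ℕ) := by norm_cast; omega
    have hhalf : 1 / 2 ≤ ((t + 1 - a : ℕ) : ℝ) / ((t + 1 - a : ℕ) + 1) := by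
      rw [div_le_div_iff₀ two_pos (by positivity)]
      linarith
    have hlast := mul_le_mul_of_nonneg_right hhalf (sq_nonneg (mean θ a t - θ (t + 1)))
    rw [Finset.sum_Ico_succ_top hat, scatter_succ θ hat]
    linarith

theorem sum_sq_mean_sub_succ_le_scatter_add_jump (h : a ≤ t) :
    ∑ s ∈ Finset.Ico a (t + 1), (mean θ a s - θ (s + 1)) ^ 2 ≤
      4 * scatter θ a t + 2 * (θ (t + 1) - θ t) ^ 2 := by
  have hlast : (θ t - mean θ a t) ^ 2 ≤ scatter θ a t :=
    Finset.single_le_sum (f := fun s => (θ s - mean θ a t) ^ 2) (fun _ _ => sq_nonneg _)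
      (Finset.mem_Icc.mpr ⟨h, le_rfl⟩)
  have hsplit : (mean θ a t - θ (t + 1)) ^ 2 ≤
      2 * (θ t - mean θ a t) ^ 2 + 2 * (θ (t + 1) - θ t) ^ 2 := by
    nlinarith [sq_nonneg ((θ t - mean θ a t) - (θ (t + 1) - θ t))]
  rw [Finset.sum_Ico_succ_top h]
  linarith [sum_sq_mean_sub_succ_le_scatter θ h]

end Scatter

section Segment

/-- The recentred and zero-padded segment `y_a, …, y_t` as a sequence on `ℕ`; `pad` is its
restriction to the padded length. -/
def padSeq (y : ℕ → ℝ) (a t u : ℕ) : ℝ :=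
  if a + u ≤ t then y (a + u) - mean y a t else 0

/-- The `i`-th Haar coefficient of level `l` of the recentred and padded segment `y_a, …, y_t`,
before thresholding. -/
def segmentCoeff (y : ℕ → ℝ) (a t l i : ℕ) : ℝ :=
  haarCoeff (2 ^ (padExp a t - 1 - l)) (padSeq y a t) i

variable (y θ : ℕ → ℝ) (a t : ℕ)

theorem isLinearMap_segmentCoeff (l i : ℕ) : IsLinearMap ℝ fun y => segmentCoeff y a t l i := by
  have hpad : IsLinearMap ℝ fun y => padSeq y a t := by
    refine ⟨fun y z => funext fun u => ?_, fun r y => funext fun u => ?_⟩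
    · simp only [padSeq, Pi.add_apply, (isLinearMap_mean a t).map_add]
      split_ifs <;> ring
    · simp only [padSeq, Pi.smul_apply, (isLinearMap_mean a t).map_smul, smul_eq_mul]
      split_ifs <;> ring
  refine ⟨fun y z => ?_, fun r y => ?_⟩
  · simp only [segmentCoeff, haarCoeff, blockSum, hpad.map_add, Pi.add_apply,
      Finset.sum_add_distrib]
    ring
  · simp only [segmentCoeff, haarCoeff, blockSum, hpad.map_smul, Pi.smul_apply, smul_eq_mul,
      ← Finset.mul_sum]
    ring

theorem length_le_two_pow_padExp : t + 1 - a ≤ 2 ^ padExp a t :=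
  Nat.le_pow_clog one_lt_two _

variable {a t} in
theorem two_pow_padExp_le (h : a ≤ t) : 2 ^ padExp a t ≤ 2 * (t + 1 - a) := by
  unfold padExp
  rcases Nat.lt_or_ge 1 (t + 1 - a) with hlen | hlen
  · have hpred := Nat.pow_pred_clog_lt_self one_lt_two hlen
    rw [← Nat.succ_pred_eq_of_pos (Nat.clog_pos one_lt_two hlen), pow_succ]
    omega
  · rw [Nat.clog_of_right_le_one hlen, pow_zero]
    omega

variable {a t} in
theorem padExp_le_log {n : ℕ} (ha : 1 ≤ a) (hat : a ≤ t) (htn : t ≤ n) :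
    (padExp a t : ℝ) ≤ 2 * (1 + Real.log n) := by
  have hn : (1 : ℝ) ≤ n := by norm_cast; omega
  have hpow : (2 : ℝ) ^ padExp a t ≤ 2 * n := by
    exact_mod_cast (two_pow_padExp_le hat).trans (by omega)
  have hlog := Real.log_le_log (by positivity) hpow
  rw [Real.log_pow, Real.log_mul two_ne_zero (by positivity)] at hlog
  nlinarith [Real.log_two_gt_d9, Real.log_two_lt_d9, Real.log_nonneg hn,
    (padExp a t).cast_nonneg (α := ℝ)]

theorem sum_padSeq_comp {F : ℝ → ℝ} (hF : F 0 = 0) :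
    ∑ u ∈ Finset.range (2 ^ padExp a t), F (padSeq y a t u) =
      ∑ s ∈ Finset.Icc a t, F (y s - mean y a t) := by
  have hzero : ∀ u ∉ Finset.range (t + 1 - a), F (padSeq y a t u) = 0 := fun u hu => by
    rw [Finset.mem_range] at hu
    rw [padSeq, if_neg (by omega), hF]
  rw [← Finset.sum_subset (Finset.range_subset_range.mpr (length_le_two_pow_padExp a t))
      fun u _ => hzero u,
    show Finset.Icc a t = Finset.Ico a (t + 1) by ext; simp, Finset.sum_Ico_eq_sum_range]
  refine Finset.sum_congr rfl fun u hu => ?_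
  rw [Finset.mem_range] at hu
  rw [padSeq, if_pos (by omega)]

theorem sum_segmentCoeff_sq :
    ∑ l ∈ Finset.range (padExp a t), ∑ i ∈ Finset.range (2 ^ l), segmentCoeff y a t l i ^ 2 =
      scatter y a t := by
  unfold segmentCoeff
  rw [sum_haarCoeff_sq_of_sum_eq_zero, sum_padSeq_comp y a t (F := (· ^ 2)) (by simp), scatter]
  exact (sum_padSeq_comp y a t (F := id) rfl).trans (sum_sub_mean y a t)

variable {a t}

theorem variation_padSeq_le (h : a ≤ t) (N : ℕ) :
    variation (padSeq θ a t) 0 N ≤ 2 * variation θ a t := by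
  have hinside : variation (padSeq θ a t) 0 (t - a) = variation θ a t := by
    unfold variation
    rw [Finset.sum_Ico_eq_sum_range, Finset.sum_Ico_eq_sum_range, Nat.sub_zero]
    refine Finset.sum_congr rfl fun u hu => ?_
    rw [Finset.mem_range] at hu
    rw [padSeq, padSeq, if_pos (by omega), if_pos (by omega), zero_add, sub_sub_sub_cancel_right,
      add_assoc]
  have hedge : variation (padSeq θ a t) (t - a) (t - a + 1) ≤ variation θ a t := by
    rw [variation, Nat.Ico_succ_singleton, Finset.sum_singleton, padSeq, padSeq,
      if_neg (by omega), if_pos (by omega), Nat.add_sub_cancel' h, zero_sub, abs_neg]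
    exact abs_last_sub_mean_le_variation θ h
  have houtside : variation (padSeq θ a t) (t - a + 1) (max N (t - a + 1)) = 0 :=
    Finset.sum_eq_zero fun u hu => by
      rw [Finset.mem_Ico] at hu
      rw [padSeq, padSeq, if_neg (by omega), if_neg (by omega), sub_self, abs_zero]
  refine (variation_mono _ le_rfl (le_max_left N (t - a + 1))).trans ?_
  rw [← variation_add_variation _ (Nat.zero_le (t - a + 1)) (le_max_right _ _),
    ← variation_add_variation _ (Nat.zero_le (t - a)) (Nat.le_succ _)]
  linarith

theorem sum_abs_segmentCoeff_le (h : a ≤ t) {l : ℕ} (hl : l < padExp a t) :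
    ∑ i ∈ Finset.range (2 ^ l), |segmentCoeff θ a t l i| ≤
      √(2 ^ (padExp a t - l)) * variation θ a t := by
  have hwidth : (2 : ℝ) * (2 ^ (padExp a t - 1 - l) : ℕ) = 2 ^ (padExp a t - l) := by
    push_cast
    rw [← pow_succ', show padExp a t - 1 - l + 1 = padExp a t - l by omega]
  refine (sum_abs_haarCoeff_le _ _ _).trans ?_
  rw [hwidth]
  calc √(2 ^ (padExp a t - l)) / 2 * variation (padSeq θ a t) 0 _
      ≤ √(2 ^ (padExp a t - l)) / 2 * (2 * variation θ a t) := by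
        gcongr
        exact variation_padSeq_le θ h _
    _ = √(2 ^ (padExp a t - l)) * variation θ a t := by ring

end Segment

section Restart

variable {σ lam : ℝ} {y : ℕ → ℝ} {a t l i : ℕ}

theorem softThreshold_of_abs_le {x : ℝ} (h : |x| ≤ lam) : softThreshold lam x = 0 := by
  rw [softThreshold, max_eq_right (sub_nonpos.mpr h), mul_zero]

theorem abs_sub_le_abs_softThreshold (hlam : 0 ≤ lam) (x : ℝ) :
    |x| - lam ≤ |softThreshold lam x| := by
  rcases eq_or_ne x 0 with rfl | hx
  · simpa [softThreshold] using hlam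
  · rw [softThreshold, abs_mul, abs_eq_abs.mpr (Real.sign_apply_eq_of_ne_zero x hx).symm, abs_one,
      one_mul]
    exact (le_max_left _ _).trans (le_abs_self _)

theorem blockNorm_thresholdedCoeffs (hl : l < padExp a t) :
    blockNorm (thresholdedCoeffs lam y a t) l =
      ∑ i ∈ Finset.range (2 ^ l), |softThreshold lam (segmentCoeff y a t l i)| := by
  have hle : 2 ^ (l + 1) ≤ 2 ^ padExp a t := Nat.pow_le_pow_right two_pos hl
  rw [pow_succ] at hle
  symm
  refine Finset.sum_bij (fun i hi => ⟨2 ^ l + i, by rw [Finset.mem_range] at hi; omega⟩)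
    (fun i hi => ?_) (fun i _ j _ hij => ?_) (fun j hj => ?_) (fun i hi => ?_)
  · rw [Finset.mem_range] at hi
    simp only [Finset.mem_filter_univ, pow_succ]
    omega
  · simpa using hij
  · simp only [Finset.mem_filter_univ, pow_succ] at hj
    exact ⟨j - 2 ^ l, by rw [Finset.mem_range]; omega, Fin.ext (by simp only; omega)⟩
  · rw [Finset.mem_range] at hi
    exact congrArg (fun x => |softThreshold lam x|) (haarMatrix_mulVec (padSeq y a t) _ rfl hi).symm

theorem restart_iff :
    Restart σ lam y a t ↔
      σ < ∑ l ∈ Finset.range (padExp a t), (2 : ℝ) ^ ((l : ℝ) / 2) *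
        ∑ i ∈ Finset.range (2 ^ l), |softThreshold lam (segmentCoeff y a t l i)| := by
  rw [Restart, one_div_mul_eq_div, div_lt_div_iff_of_pos_right (by positivity)]
  refine iff_of_eq (congrArg (σ < ·) (Finset.sum_congr rfl fun l hl => ?_))
  rw [blockNorm_thresholdedCoeffs (Finset.mem_range.mp hl)]

theorem exists_lt_abs_segmentCoeff_of_restart (hσ : 0 ≤ σ) (h : Restart σ lam y a t) :
    ∃ l < padExp a t, ∃ i < 2 ^ l, lam < |segmentCoeff y a t l i| := by
  by_contra! hsmall
  refine (restart_iff.mp h).not_ge ((Finset.sum_eq_zero fun l hl => ?_).trans_le hσ)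
  rw [Finset.sum_eq_zero, mul_zero]
  intro i hi
  rw [softThreshold_of_abs_le (hsmall l (Finset.mem_range.mp hl) i (Finset.mem_range.mp hi)),
    abs_zero]

theorem abs_segmentCoeff_le_of_not_restart (hlam : 0 ≤ lam) (h : ¬ Restart σ lam y a t)
    (hl : l < padExp a t) (hi : i < 2 ^ l) : |segmentCoeff y a t l i| ≤ σ + lam := by
  rw [restart_iff, not_lt] at h
  have hblock : 0 ≤ ∑ i ∈ Finset.range (2 ^ l), |softThreshold lam (segmentCoeff y a t l i)| :=
    Finset.sum_nonneg fun _ _ => abs_nonneg _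
  have hthreshold : |softThreshold lam (segmentCoeff y a t l i)| ≤ σ :=
    calc |softThreshold lam (segmentCoeff y a t l i)|
        ≤ ∑ i ∈ Finset.range (2 ^ l), |softThreshold lam (segmentCoeff y a t l i)| :=
          Finset.single_le_sum (f := fun i => |softThreshold lam (segmentCoeff y a t l i)|)
            (fun _ _ => abs_nonneg _) (Finset.mem_range.mpr hi)
      _ ≤ (2 : ℝ) ^ ((l : ℝ) / 2) *
            ∑ i ∈ Finset.range (2 ^ l), |softThreshold lam (segmentCoeff y a t l i)| :=
          le_mul_of_one_le_left hblock (Real.one_le_rpow one_le_two (by positivity))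
      _ ≤ σ := (Finset.single_le_sum (f := fun l : ℕ => (2 : ℝ) ^ ((l : ℝ) / 2) *
            ∑ i ∈ Finset.range (2 ^ l), |softThreshold lam (segmentCoeff y a t l i)|)
            (fun _ _ => by positivity) (Finset.mem_range.mpr hl)).trans h
  linarith [abs_sub_le_abs_softThreshold hlam (segmentCoeff y a t l i)]

end Restart

section Rate

theorem rpow_mul_rpow_add_le {p q x₁ x₂ v₁ v₂ : ℝ} (hp : 0 < p) (hq : 0 < q) (hpq : p + q = 1)
    (hx₁ : 0 ≤ x₁) (hx₂ : 0 ≤ x₂) (hv₁ : 0 ≤ v₁) (hv₂ : 0 ≤ v₂) :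
    x₁ ^ p * v₁ ^ q + x₂ ^ p * v₂ ^ q ≤ (x₁ + x₂) ^ p * (v₁ + v₂) ^ q := by
  have hf : ∀ i, 0 ≤ ![x₁ ^ p, x₂ ^ p] i :=
    Fin.forall_fin_two.mpr ⟨Real.rpow_nonneg hx₁ p, Real.rpow_nonneg hx₂ p⟩
  have hg : ∀ i, 0 ≤ ![v₁ ^ q, v₂ ^ q] i :=
    Fin.forall_fin_two.mpr ⟨Real.rpow_nonneg hv₁ q, Real.rpow_nonneg hv₂ q⟩
  have hholder := Real.inner_le_Lp_mul_Lq_of_nonneg (s := Finset.univ)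
    (Real.HolderConjugate.inv_inv hp hq hpq) (fun i _ => hf i) (fun i _ => hg i)
  simpa [Fin.sum_univ_two, ← Real.rpow_mul, hx₁, hx₂, hv₁, hv₂, hp.ne', hq.ne'] using hholder

/-- The minimax rate of a segment of length `L` on which `θ` has total variation `V`, at noise
level `lam`. -/
def rate (lam : ℝ) (θ : ℕ → ℝ) (a t : ℕ) : ℝ :=
  lam ^ (4 / 3 : ℝ) * (((t + 1 - a : ℕ) : ℝ) ^ (1 / 3 : ℝ) * variation θ a t ^ (2 / 3 : ℝ))

variable {lam : ℝ} (hlam : 0 ≤ lam) (θ : ℕ → ℝ) {a t : ℕ}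
include hlam

theorem rate_nonneg : 0 ≤ rate lam θ a t :=
  mul_nonneg (Real.rpow_nonneg hlam _)
    (mul_nonneg (Real.rpow_nonneg (Nat.cast_nonneg _) _)
      (Real.rpow_nonneg (variation_nonneg θ a t) _))

theorem rate_pow_three :
    rate lam θ a t ^ 3 = lam ^ 4 * ((t + 1 - a : ℕ) : ℝ) * variation θ a t ^ 2 := by
  have hcube : ∀ x : ℝ, 0 ≤ x → ∀ k : ℕ, (x ^ (k / 3 : ℝ)) ^ 3 = x ^ k := fun x hx k => by
    rw [← Real.rpow_mul_natCast hx, Nat.cast_ofNat, div_mul_cancel₀ _ three_ne_zero,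
      Real.rpow_natCast]
  have hlam_cube := hcube lam hlam 4
  have hlen_cube := hcube _ (Nat.cast_nonneg (t + 1 - a)) 1
  have hvar_cube := hcube _ (variation_nonneg θ a t) 2
  push_cast at hlam_cube hlen_cube hvar_cube
  rw [rate, mul_pow, mul_pow, hlam_cube, hlen_cube, hvar_cube, pow_one, mul_assoc]

theorem le_mul_rate_of_pow_three_le {c q : ℝ} (hc : 0 ≤ c)
    (h : q ^ 3 ≤ c ^ 3 * (lam ^ 4 * ((t + 1 - a : ℕ) : ℝ) * variation θ a t ^ 2)) :
    q ≤ c * rate lam θ a t := by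
  refine le_of_pow_le_pow_left₀ three_ne_zero (mul_nonneg hc (rate_nonneg hlam θ)) ?_
  rwa [mul_pow, rate_pow_three hlam]

theorem rate_mono_right {b : ℕ} (h : t ≤ b) : rate lam θ a t ≤ rate lam θ a b := by
  have := variation_nonneg θ a t
  have := variation_mono θ (le_refl a) h
  unfold rate
  gcongr

theorem rate_add_rate_le {p : ℕ} (ha : a ≤ p + 1) (ht : p ≤ t) :
    rate lam θ a p + rate lam θ (p + 1) t ≤ rate lam θ a t := by
  have hlen : ((p + 1 - a : ℕ) : ℝ) + ((t + 1 - (p + 1) : ℕ) : ℝ) = ((t + 1 - a : ℕ) : ℝ) := by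
    norm_cast; omega
  have hvar := variation_add_variation_le θ ha p.le_succ ht
  have hleft := variation_nonneg θ a p
  have hright := variation_nonneg θ (p + 1) t
  unfold rate
  rw [← mul_add, ← hlen]
  refine mul_le_mul_of_nonneg_left ?_ (Real.rpow_nonneg hlam _)
  refine (rpow_mul_rpow_add_le (by norm_num) (by norm_num) (by norm_num) (Nat.cast_nonneg _)
    (Nat.cast_nonneg _) hleft hright).trans ?_
  gcongr

end Rate

section SegmentNoise

/-- The good event of a segment: all Haar coefficients and the normalized sum
`√(t + 1 - a) * mean` of the noise are at most `κ`. All of them are linear functionals of norm at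
most `1`, so subgaussian with the parameter of the noise. -/
structure SegmentNoiseBound (κ : ℝ) (z : ℕ → ℝ) (a t : ℕ) : Prop where
  coeff : ∀ l < padExp a t, ∀ i < 2 ^ l, |segmentCoeff z a t l i| ≤ κ
  mean : √((t + 1 - a : ℕ) : ℝ) * |mean z a t| ≤ κ

variable {σ lam : ℝ} {θ z : ℕ → ℝ} {a t : ℕ}

theorem sq_le_two_mul_rate_of_restart (hσ : 0 ≤ σ) (hlam : 0 ≤ lam) (hat : a ≤ t)
    (hz : SegmentNoiseBound (lam / 2) z a t) (h : Restart σ lam (θ + z) a t) :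
    lam ^ 2 ≤ 2 * rate lam θ a t := by
  obtain ⟨l, hl, i, hi, hlt⟩ := exists_lt_abs_segmentCoeff_of_restart hσ h
  rw [(isLinearMap_segmentCoeff a t l i).map_add] at hlt
  have hcoeff : lam / 2 ≤ √(2 ^ (padExp a t - l)) * variation θ a t :=
    calc lam / 2 ≤ |segmentCoeff θ a t l i| := by
          linarith [abs_add_le (segmentCoeff θ a t l i) (segmentCoeff z a t l i),
            hz.coeff l hl i hi]
      _ ≤ ∑ i ∈ Finset.range (2 ^ l), |segmentCoeff θ a t l i| :=
          Finset.single_le_sum (f := fun i => |segmentCoeff θ a t l i|) (fun _ _ => abs_nonneg _)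
            (Finset.mem_range.mpr hi)
      _ ≤ _ := sum_abs_segmentCoeff_le θ hat hl
  have hlen : (2 : ℝ) ^ (padExp a t - l) ≤ 2 * ((t + 1 - a : ℕ) : ℝ) :=
    (pow_le_pow_right₀ one_le_two (Nat.sub_le _ _)).trans (by exact_mod_cast two_pow_padExp_le hat)
  have hsq : lam ^ 2 ≤ 8 * (((t + 1 - a : ℕ) : ℝ) * variation θ a t ^ 2) :=
    calc lam ^ 2 = 4 * (lam / 2) ^ 2 := by ring
      _ ≤ 4 * (√(2 ^ (padExp a t - l)) * variation θ a t) ^ 2 := by gcongr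
      _ = 4 * (2 ^ (padExp a t - l) * variation θ a t ^ 2) := by
          rw [mul_pow, Real.sq_sqrt (by positivity)]
      _ ≤ 4 * (2 * ((t + 1 - a : ℕ) : ℝ) * variation θ a t ^ 2) := by gcongr
      _ = 8 * (((t + 1 - a : ℕ) : ℝ) * variation θ a t ^ 2) := by ring
  refine le_mul_rate_of_pow_three_le hlam θ zero_le_two ?_
  calc (lam ^ 2) ^ 3 = lam ^ 4 * lam ^ 2 := by ring
    _ ≤ lam ^ 4 * (8 * (((t + 1 - a : ℕ) : ℝ) * variation θ a t ^ 2)) := by gcongr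
    _ = 2 ^ 3 * (lam ^ 4 * ((t + 1 - a : ℕ) : ℝ) * variation θ a t ^ 2) := by ring

-- The energy of the level is at most `2 ^ l * sup²` and at most `sup * ℓ¹`; its cube is bounded by
-- the former times the square of the latter.
theorem sum_segmentCoeff_sq_le_rate (hlam : 0 ≤ lam) (hat : a ≤ t) {l : ℕ} (hl : l < padExp a t)
    (hcoeff : ∀ i < 2 ^ l, |segmentCoeff θ a t l i| ≤ 3 * lam) :
    ∑ i ∈ Finset.range (2 ^ l), segmentCoeff θ a t l i ^ 2 ≤ 6 * rate lam θ a t := by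
  set energy := ∑ i ∈ Finset.range (2 ^ l), segmentCoeff θ a t l i ^ 2
  set V := variation θ a t
  have : 0 ≤ energy := Finset.sum_nonneg fun _ _ => sq_nonneg _
  have hsup : energy ≤ 2 ^ l * (3 * lam) ^ 2 :=
    (Finset.sum_le_card_nsmul _ _ ((3 * lam) ^ 2) fun i hi =>
      sq_le_sq' (abs_le.mp (hcoeff i (Finset.mem_range.mp hi))).1
        (abs_le.mp (hcoeff i (Finset.mem_range.mp hi))).2).trans_eq (by simp)
  have hl1 : energy ≤ 3 * lam * (√(2 ^ (padExp a t - l)) * V) :=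
    calc energy ≤ ∑ i ∈ Finset.range (2 ^ l), 3 * lam * |segmentCoeff θ a t l i| :=
          Finset.sum_le_sum fun i hi => by
            rw [← sq_abs, sq]
            exact mul_le_mul_of_nonneg_right (hcoeff i (Finset.mem_range.mp hi)) (abs_nonneg _)
      _ = 3 * lam * ∑ i ∈ Finset.range (2 ^ l), |segmentCoeff θ a t l i| := by rw [Finset.mul_sum]
      _ ≤ 3 * lam * (√(2 ^ (padExp a t - l)) * V) := by
          gcongr
          exact sum_abs_segmentCoeff_le θ hat hl
  have hlen : (2 : ℝ) ^ l * 2 ^ (padExp a t - l) ≤ 2 * ((t + 1 - a : ℕ) : ℝ) := by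
    rw [← pow_add, Nat.add_sub_cancel' hl.le]
    exact_mod_cast two_pow_padExp_le hat
  have hnonneg : 0 ≤ lam ^ 4 * ((t + 1 - a : ℕ) : ℝ) * V ^ 2 := by positivity
  refine le_mul_rate_of_pow_three_le hlam θ (by norm_num) ?_
  calc energy ^ 3 = energy * energy ^ 2 := by ring
    _ ≤ 2 ^ l * (3 * lam) ^ 2 * (3 * lam * (√(2 ^ (padExp a t - l)) * V)) ^ 2 := by gcongr
    _ = 81 * lam ^ 4 * V ^ 2 * (2 ^ l * 2 ^ (padExp a t - l)) := by
        rw [mul_pow (3 * lam), mul_pow √_, Real.sq_sqrt (by positivity)]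
        ring
    _ ≤ 81 * lam ^ 4 * V ^ 2 * (2 * ((t + 1 - a : ℕ) : ℝ)) := by gcongr
    _ ≤ 6 ^ 3 * (lam ^ 4 * ((t + 1 - a : ℕ) : ℝ) * V ^ 2) := by linarith

theorem scatter_le_of_not_restart (hσ : σ ≤ lam) (hlam : 0 ≤ lam) (hat : a ≤ t)
    (hz : SegmentNoiseBound (lam / 2) z a t) (h : ¬ Restart σ lam (θ + z) a t) :
    scatter θ a t ≤ padExp a t * (6 * rate lam θ a t) := by
  rw [← sum_segmentCoeff_sq θ]
  refine (Finset.sum_le_card_nsmul _ _ (6 * rate lam θ a t) fun l hl => ?_).trans_eq (by simp)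
  rw [Finset.mem_range] at hl
  refine sum_segmentCoeff_sq_le_rate hlam hat hl fun i hi => ?_
  have hobs := abs_segmentCoeff_le_of_not_restart hlam h hl hi
  have hnoise := hz.coeff l hl i hi
  rw [(isLinearMap_segmentCoeff a t l i).map_add] at hobs
  rw [abs_le] at hobs hnoise ⊢
  constructor <;> linarith

theorem sum_sq_mean_le_of_segmentNoiseBound {κ : ℝ} {n b : ℕ} (ha : 1 ≤ a) (hb : b ≤ n)
    (hz : ∀ t, a ≤ t → t < b → SegmentNoiseBound κ z a t) :
    ∑ t ∈ Finset.Ico a b, mean z a t ^ 2 ≤ κ ^ 2 * (1 + Real.log n) := by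
  have hmean : ∀ k ∈ Finset.range (b - a), mean z a (a + k) ^ 2 ≤ κ ^ 2 * ((k : ℝ) + 1)⁻¹ := by
    intro k hk
    rw [Finset.mem_range] at hk
    have hnoise := pow_le_pow_left₀ (by positivity)
      (hz (a + k) (by omega) (by omega)).mean 2
    rw [mul_pow, sq_abs, Real.sq_sqrt (Nat.cast_nonneg _), show a + k + 1 - a = k + 1 by omega,
      Nat.cast_succ] at hnoise
    rwa [← div_eq_mul_inv, le_div_iff₀ (by positivity), mul_comm]
  calc ∑ t ∈ Finset.Ico a b, mean z a t ^ 2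
      = ∑ k ∈ Finset.range (b - a), mean z a (a + k) ^ 2 := Finset.sum_Ico_eq_sum_range _ _ _
    _ ≤ κ ^ 2 * ∑ k ∈ Finset.range (b - a), ((k : ℝ) + 1)⁻¹ := by
        rw [Finset.mul_sum]
        exact Finset.sum_le_sum hmean
    _ ≤ κ ^ 2 * ∑ k ∈ Finset.range n, ((k : ℝ) + 1)⁻¹ := by
        gcongr
        omega
    _ ≤ κ ^ 2 * (1 + Real.log n) := by
        gcongr
        simpa [harmonic] using harmonic_le_one_add_log n

end SegmentNoise

section Bins

/-- The good event of the whole horizon: the noise is bounded on every segment of the rounds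
`1, …, n`. -/
def NoiseBound (n : ℕ) (κ : ℝ) (z : ℕ → ℝ) : Prop :=
  ∀ a t, 1 ≤ a → a ≤ t → t ≤ n → SegmentNoiseBound κ z a t

/-- The bin that opens in round `p + 1` has not been closed by the restart rule in any of the
rounds `p + 1, …, t`. For `t = p` none of these rounds has been played yet. -/
structure IsOpenBin (σ lam : ℝ) (y : ℕ → ℝ) (p t : ℕ) : Prop where
  le : p ≤ t
  binStart_left : binStart σ lam y p = p + 1
  not_restart : ∀ s, p < s → s ≤ t → ¬ Restart σ lam y (p + 1) s

variable {σ lam : ℝ} {y : ℕ → ℝ} {p t : ℕ}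

theorem isOpenBin_zero : IsOpenBin σ lam y 0 0 where
  le := le_rfl
  binStart_left := rfl
  not_restart s hs hs' := by omega

theorem IsOpenBin.binStart_eq (h : IsOpenBin σ lam y p t) {s : ℕ} (hps : p ≤ s) (hst : s ≤ t) :
    binStart σ lam y s = p + 1 := by
  induction s, hps using Nat.le_induction with
  | base => exact h.binStart_left
  | succ s hps ih =>
    rw [binStart, ih (by omega), if_neg (h.not_restart (s + 1) (by omega) hst)]

theorem IsOpenBin.succ_of_restart (h : IsOpenBin σ lam y p t)
    (hrestart : Restart σ lam y (p + 1) (t + 1)) : IsOpenBin σ lam y (t + 1) (t + 1) where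
  le := le_rfl
  binStart_left := by rw [binStart, h.binStart_eq h.le le_rfl, if_pos hrestart]
  not_restart s hs hs' := by omega

theorem IsOpenBin.succ_of_not_restart (h : IsOpenBin σ lam y p t)
    (hrestart : ¬ Restart σ lam y (p + 1) (t + 1)) : IsOpenBin σ lam y p (t + 1) where
  le := h.le.trans t.le_succ
  binStart_left := h.binStart_left
  not_restart s hs hs' := by
    rcases hs'.lt_or_eq with hlt | rfl
    · exact h.not_restart s hs (Nat.lt_succ_iff.mp hlt)
    · exact hrestart

theorem IsOpenBin.sum_sq_predict_sub (h : IsOpenBin σ lam y p t) (θ : ℕ → ℝ) :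
    ∑ s ∈ Finset.Ico p (t + 1), (predict σ lam y s - θ (s + 1)) ^ 2 = (y p - θ (p + 1)) ^ 2 +
      ∑ s ∈ Finset.Ico (p + 1) (t + 1), (mean y (p + 1) s - θ (s + 1)) ^ 2 := by
  rw [Finset.sum_eq_sum_Ico_succ_bot (by have := h.le; omega), predict, if_pos h.binStart_left]
  congr 1
  refine Finset.sum_congr rfl fun s hs => ?_
  rw [Finset.mem_Ico] at hs
  rw [predict, h.binStart_eq (by omega) (by omega), if_neg (by omega)]

variable {θ z : ℕ → ℝ} {n : ℕ}

theorem sum_sq_mean_sub_succ_le_rate {a b : ℕ} (hσ : σ ≤ lam) (hlam : 0 ≤ lam) (ha : 1 ≤ a)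
    (hbn : b ≤ n) (hz : NoiseBound n (lam / 2) z)
    (h : ∀ t, a ≤ t → t < b → ¬ Restart σ lam (θ + z) a t) :
    ∑ t ∈ Finset.Ico a b, (mean θ a t - θ (t + 1)) ^ 2 ≤
      48 * (1 + Real.log n) * rate lam θ a b +
        2 * ∑ t ∈ Finset.Ico a b, (θ (t + 1) - θ t) ^ 2 := by
  have : 0 ≤ Real.log n := Real.log_natCast_nonneg n
  have hrate := rate_nonneg hlam θ (a := a) (t := b)
  rcases Nat.lt_or_ge a b with hab | hab
  · obtain ⟨c, rfl⟩ : ∃ c, b = c + 1 := ⟨b - 1, by omega⟩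
    have hac : a ≤ c := by omega
    have hscatter : scatter θ a c ≤ 2 * (1 + Real.log n) * (6 * rate lam θ a (c + 1)) :=
      calc scatter θ a c ≤ padExp a c * (6 * rate lam θ a c) :=
            scatter_le_of_not_restart hσ hlam hac (hz a c ha hac (by omega))
              (h c hac c.lt_succ_self)
        _ ≤ 2 * (1 + Real.log n) * (6 * rate lam θ a (c + 1)) := by
            gcongr
            · exact mul_nonneg (by norm_num) (rate_nonneg hlam θ)
            · exact padExp_le_log ha hac (by omega)
            · exact rate_mono_right hlam θ c.le_succ
    have hjump : (θ (c + 1) - θ c) ^ 2 ≤ ∑ t ∈ Finset.Ico a (c + 1), (θ (t + 1) - θ t) ^ 2 :=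
      Finset.single_le_sum (f := fun t => (θ (t + 1) - θ t) ^ 2)
        (fun _ _ => sq_nonneg _) (Finset.mem_Ico.mpr ⟨hac, c.lt_succ_self⟩)
    linarith [sum_sq_mean_sub_succ_le_scatter_add_jump θ hac]
  · rw [Finset.Ico_eq_empty (by omega), Finset.sum_empty, Finset.sum_empty]
    positivity

theorem sum_sq_mean_add_sub_succ_le_rate {a b : ℕ} (hσ : σ ≤ lam) (hlam : 0 ≤ lam) (ha : 1 ≤ a)
    (hbn : b ≤ n) (hz : NoiseBound n (lam / 2) z)
    (h : ∀ t, a ≤ t → t < b → ¬ Restart σ lam (θ + z) a t) :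
    ∑ t ∈ Finset.Ico a b, (mean (θ + z) a t - θ (t + 1)) ^ 2 ≤
      lam ^ 2 / 2 * (1 + Real.log n) + 96 * (1 + Real.log n) * rate lam θ a b +
        4 * ∑ t ∈ Finset.Ico a b, (θ (t + 1) - θ t) ^ 2 := by
  have hsplit : ∀ t, (mean (θ + z) a t - θ (t + 1)) ^ 2 ≤
      2 * (mean θ a t - θ (t + 1)) ^ 2 + 2 * mean z a t ^ 2 := fun t => by
    rw [(isLinearMap_mean a t).map_add]
    nlinarith [sq_nonneg (mean z a t - (mean θ a t - θ (t + 1)))]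
  calc ∑ t ∈ Finset.Ico a b, (mean (θ + z) a t - θ (t + 1)) ^ 2
      ≤ 2 * ∑ t ∈ Finset.Ico a b, (mean θ a t - θ (t + 1)) ^ 2 +
          2 * ∑ t ∈ Finset.Ico a b, mean z a t ^ 2 := by
        rw [Finset.mul_sum, Finset.mul_sum, ← Finset.sum_add_distrib]
        exact Finset.sum_le_sum fun t _ => hsplit t
    _ ≤ 2 * (48 * (1 + Real.log n) * rate lam θ a b +
          2 * ∑ t ∈ Finset.Ico a b, (θ (t + 1) - θ t) ^ 2) +
          2 * ((lam / 2) ^ 2 * (1 + Real.log n)) := by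
        gcongr
        · exact sum_sq_mean_sub_succ_le_rate hσ hlam ha hbn hz h
        · exact sum_sq_mean_le_of_segmentNoiseBound ha hbn fun t hat htb =>
            hz a t ha hat (by omega)
    _ = _ := by ring

theorem IsOpenBin.sum_sq_predict_sub_le (hσ : σ ≤ lam) (hlam : 0 ≤ lam) (hz₀ : z 0 = 0)
    (hz : NoiseBound n (lam / 2) z) (h : IsOpenBin σ lam (θ + z) p t) (htn : t < n) :
    ∑ s ∈ Finset.Ico p (t + 1), (predict σ lam (θ + z) s - θ (s + 1)) ^ 2 ≤
      lam ^ 2 * (1 + Real.log n) + 96 * (1 + Real.log n) * rate lam θ (p + 1) (t + 1) +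
        4 * ∑ s ∈ Finset.Ico p (t + 1), (θ (s + 1) - θ s) ^ 2 := by
  have hpt := h.le
  have hzp : z p ^ 2 ≤ (lam / 2) ^ 2 := by
    rcases p.eq_zero_or_pos with rfl | hp
    · rw [hz₀, zero_pow two_ne_zero]
      positivity
    · have hmean := (hz p p hp le_rfl (by omega)).mean
      simp only [Nat.add_sub_cancel_left, Nat.cast_one, Real.sqrt_one, one_mul, mean,
        Finset.Icc_self, Finset.sum_singleton, div_one] at hmean
      exact sq_le_sq' (abs_le.mp hmean).1 (abs_le.mp hmean).2
  have hfirst : ((θ + z) p - θ (p + 1)) ^ 2 ≤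
      lam ^ 2 / 2 + 2 * (θ (p + 1) - θ p) ^ 2 := by
    rw [Pi.add_apply]
    nlinarith [sq_nonneg (z p + (θ (p + 1) - θ p))]
  have hrest := sum_sq_mean_add_sub_succ_le_rate (a := p + 1) (b := t + 1) hσ hlam
    (by omega) (by omega) hz fun s hps hst => h.not_restart s hps (Nat.lt_succ_iff.mp hst)
  rw [h.sum_sq_predict_sub, Finset.sum_eq_sum_Ico_succ_bot (by omega : p < t + 1)
    fun s => (θ (s + 1) - θ s) ^ 2]
  have hlog : 0 ≤ lam ^ 2 * Real.log n :=
    mul_nonneg (sq_nonneg lam) (Real.log_natCast_nonneg n)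
  linarith [sq_nonneg (θ (p + 1) - θ p), sq_nonneg lam]

-- Every closed bin pays the `lam ^ 2 * (1 + log n)` that its noise costs from its own rate.
theorem exists_isOpenBin (hσ₀ : 0 ≤ σ) (hσ : σ ≤ lam) (hz₀ : z 0 = 0)
    (hz : NoiseBound n (lam / 2) z) (htn : t ≤ n) :
    ∃ p, IsOpenBin σ lam (θ + z) p t ∧
      ∑ s ∈ Finset.range p, (predict σ lam (θ + z) s - θ (s + 1)) ^ 2 ≤
        98 * (1 + Real.log n) * rate lam θ 1 p +
          4 * ∑ s ∈ Finset.range p, (θ (s + 1) - θ s) ^ 2 := by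
  have hlam := hσ₀.trans hσ
  have : 0 ≤ Real.log n := Real.log_natCast_nonneg n
  induction t with
  | zero =>
    refine ⟨0, isOpenBin_zero, ?_⟩
    have := rate_nonneg hlam θ (a := 1) (t := 0)
    simp only [Finset.range_zero, Finset.sum_empty]
    positivity
  | succ t ih =>
    obtain ⟨p, hopen, herror⟩ := ih (by omega)
    have hpt := hopen.le.trans t.le_succ
    by_cases hrestart : Restart σ lam (θ + z) (p + 1) (t + 1)
    · refine ⟨t + 1, hopen.succ_of_restart hrestart, ?_⟩
      have hbin := hopen.sum_sq_predict_sub_le hσ hlam hz₀ hz htn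
      have hpaid : lam ^ 2 * (1 + Real.log n) ≤
          2 * rate lam θ (p + 1) (t + 1) * (1 + Real.log n) := by
        gcongr
        exact sq_le_two_mul_rate_of_restart hσ₀ hlam (Nat.succ_le_succ hopen.le)
          (hz (p + 1) (t + 1) p.succ_pos (Nat.succ_le_succ hopen.le) htn) hrestart
      have hrate : 98 * (1 + Real.log n) * (rate lam θ 1 p + rate lam θ (p + 1) (t + 1)) ≤
          98 * (1 + Real.log n) * rate lam θ 1 (t + 1) := by
        gcongr
        exact rate_add_rate_le hlam θ (by omega) hpt
      rw [← Finset.sum_range_add_sum_Ico _ hpt,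
        ← Finset.sum_range_add_sum_Ico (fun s => (θ (s + 1) - θ s) ^ 2) hpt]
      linarith
    · exact ⟨p, hopen.succ_of_not_restart hrestart, herror⟩

theorem sum_sq_predict_sub_le (hσ₀ : 0 ≤ σ) (hσ : σ ≤ lam) (hz₀ : z 0 = 0)
    (hz : NoiseBound n (lam / 2) z) (htn : t < n) :
    ∑ s ∈ Finset.range (t + 1), (predict σ lam (θ + z) s - θ (s + 1)) ^ 2 ≤
      lam ^ 2 * (1 + Real.log n) + 98 * (1 + Real.log n) * rate lam θ 1 (t + 1) +
        4 * ∑ s ∈ Finset.range (t + 1), (θ (s + 1) - θ s) ^ 2 := by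
  have hlam := hσ₀.trans hσ
  have : 0 ≤ Real.log n := Real.log_natCast_nonneg n
  obtain ⟨p, hopen, herror⟩ := exists_isOpenBin (θ := θ) hσ₀ hσ hz₀ hz htn.le
  have hpt := hopen.le.trans t.le_succ
  have hbin := hopen.sum_sq_predict_sub_le hσ hlam hz₀ hz htn
  have hrate : 98 * (1 + Real.log n) * (rate lam θ 1 p + rate lam θ (p + 1) (t + 1)) ≤
      98 * (1 + Real.log n) * rate lam θ 1 (t + 1) := by
    gcongr
    exact rate_add_rate_le hlam θ (by omega) hpt
  have hopen_rate : 0 ≤ (1 + Real.log n) * rate lam θ (p + 1) (t + 1) :=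
    mul_nonneg (by positivity) (rate_nonneg hlam θ)
  rw [← Finset.sum_range_add_sum_Ico _ hpt,
    ← Finset.sum_range_add_sum_Ico (fun s => (θ (s + 1) - θ s) ^ 2) hpt]
  linarith

end Bins

section Causality

variable (σ lam : ℝ) {y y' : ℕ → ℝ} {t : ℕ}

theorem mean_congr (h : ∀ s ≤ t, y s = y' s) (a : ℕ) : mean y a t = mean y' a t := by
  rw [mean, mean, Finset.sum_congr rfl fun s hs => h s (Finset.mem_Icc.mp hs).2]

theorem restart_congr (h : ∀ s ≤ t, y s = y' s) (a : ℕ) :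
    Restart σ lam y a t ↔ Restart σ lam y' a t := by
  have hpad : pad y a t = pad y' a t := funext fun j => by
    rw [pad, pad, mean_congr h]
    exact ite_congr rfl (fun hj => by rw [h _ hj]) fun _ => rfl
  have hcoeffs : thresholdedCoeffs lam y a t = thresholdedCoeffs lam y' a t := funext fun j => by
    rw [thresholdedCoeffs, thresholdedCoeffs, hpad]
  rw [Restart, Restart, hcoeffs]

theorem binStart_congr (h : ∀ s ≤ t, y s = y' s) : binStart σ lam y t = binStart σ lam y' t := by
  induction t with
  | zero => rfl
  | succ t ih =>
    rw [binStart, binStart, ih fun s hs => h s (hs.trans t.le_succ)]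
    classical
    exact ite_congr (propext (restart_congr σ lam h _)) (fun _ => rfl) fun _ => rfl

theorem predict_congr (h : ∀ s ≤ t, y s = y' s) : predict σ lam y t = predict σ lam y' t := by
  rw [predict, predict, binStart_congr σ lam h, h t le_rfl, mean_congr h]

end Causality

section Policy

variable {n : ℕ} (θ z : Fin n → ℝ)

theorem isLinearMap_extendZero : IsLinearMap ℝ (extendZero (i := n)) where
  map_add y z := funext fun s => by
    simp only [extendZero, Pi.add_apply]
    split_ifs <;> simp only [add_zero]
  map_smul r y := funext fun s => by
    simp only [extendZero, Pi.smul_apply, smul_eq_mul]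
    split_ifs <;> simp only [mul_zero]

theorem extendZero_zero : extendZero z 0 = 0 :=
  dif_neg fun h => Nat.not_succ_le_zero 0 h.1

theorem extendZero_succ (t : Fin n) : extendZero z (t + 1) = z t :=
  dif_pos ⟨t.val.succ_pos, t.isLt⟩

theorem extendZero_castLE {t s : ℕ} (htn : t ≤ n) (hst : s ≤ t) :
    extendZero (fun i : Fin t => z (i.castLE htn)) s = extendZero z s := by
  rcases s.eq_zero_or_pos with rfl | hs
  · rw [extendZero_zero, extendZero_zero]
  · rw [extendZero, extendZero, dif_pos ⟨hs, hst⟩, dif_pos ⟨hs, hst.trans htn⟩]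
    rfl

theorem cumulativeError_policy (σ β : ℝ) :
    cumulativeError (policy n σ β) θ (fun t => θ t + z t) =
      ∑ s ∈ Finset.range n, (predict σ (σ * √(β * Real.log n))
        (extendZero θ + extendZero z) s - extendZero θ (s + 1)) ^ 2 := by
  rw [cumulativeError, Finset.sum_range]
  refine Finset.sum_congr rfl fun t _ => ?_
  rw [extendZero_succ, ← isLinearMap_extendZero.map_add, policy]
  congr 2
  exact predict_congr _ _ fun s hs => extendZero_castLE (θ + z) t.isLt.le hs

theorem sum_range_sq_extendZero_sub (hn : 0 < n) :
    ∑ s ∈ Finset.range n, (extendZero θ (s + 1) - extendZero θ s) ^ 2 =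
      |θ ⟨0, hn⟩| ^ 2 + ∑ i, diff θ i ^ 2 := by
  obtain ⟨m, rfl⟩ : ∃ m, n = m + 1 := ⟨n - 1, (Nat.succ_pred_eq_of_pos hn).symm⟩
  rw [Finset.sum_range_succ', add_comm, Finset.sum_range, sq_abs, extendZero_zero, sub_zero]
  congr 1
  refine Finset.sum_congr rfl fun i _ => ?_
  rw [diff, ← extendZero_succ θ, ← extendZero_succ θ]

theorem variation_extendZero : variation (extendZero θ) 1 n = ∑ i, |diff θ i| := by
  rw [variation, Finset.sum_Ico_eq_sum_range, Finset.sum_range]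
  refine Finset.sum_congr rfl fun i _ => ?_
  rw [diff, ← extendZero_succ θ, ← extendZero_succ θ, add_comm 1]

theorem rate_extendZero_le {σ B : ℝ} (hσ : 0 ≤ σ) (hB : 1 ≤ B) :
    rate (σ * √B) (extendZero θ) 1 n ≤
      B * ((n : ℝ) ^ (1 / 3 : ℝ) * (∑ i, |diff θ i|) ^ (2 / 3 : ℝ) * σ ^ (4 / 3 : ℝ)) := by
  have hpow : √B ^ (4 / 3 : ℝ) ≤ B :=
    calc √B ^ (4 / 3 : ℝ) ≤ √B ^ (2 : ℝ) :=
          Real.rpow_le_rpow_of_exponent_le (Real.one_le_sqrt.mpr hB) (by norm_num)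
      _ = B := by rw [Real.rpow_two, Real.sq_sqrt (zero_le_one.trans hB)]
  have : 0 ≤ ∑ i, |diff θ i| := Finset.sum_nonneg fun _ _ => abs_nonneg _
  rw [rate, variation_extendZero, Nat.add_sub_cancel, Real.mul_rpow hσ (Real.sqrt_nonneg B)]
  calc σ ^ (4 / 3 : ℝ) * √B ^ (4 / 3 : ℝ) *
        ((n : ℝ) ^ (1 / 3 : ℝ) * (∑ i, |diff θ i|) ^ (2 / 3 : ℝ))
      ≤ σ ^ (4 / 3 : ℝ) * B * ((n : ℝ) ^ (1 / 3 : ℝ) * (∑ i, |diff θ i|) ^ (2 / 3 : ℝ)) := by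
        gcongr
    _ = _ := by ring

theorem cumulativeError_policy_le {σ β : ℝ} (hn : 0 < n) (hσ : 0 ≤ σ) (hβ : 1 ≤ β * Real.log n)
    (hz : NoiseBound n (σ * √(β * Real.log n) / 2) (extendZero z)) :
    cumulativeError (policy n σ β) θ (fun t => θ t + z t) ≤
      98 * (β * Real.log n) * (1 + Real.log n) *
        ((n : ℝ) ^ (1 / 3 : ℝ) * (∑ i, |diff θ i|) ^ (2 / 3 : ℝ) * σ ^ (4 / 3 : ℝ) +
          |θ ⟨0, hn⟩| ^ 2 + ∑ i, diff θ i ^ 2 + σ ^ 2) := by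
  set B := β * Real.log n
  set R := (n : ℝ) ^ (1 / 3 : ℝ) * (∑ i, |diff θ i|) ^ (2 / 3 : ℝ) * σ ^ (4 / 3 : ℝ)
  set D := |θ ⟨0, hn⟩| ^ 2 + ∑ i, diff θ i ^ 2 with hD
  have hlog : 0 ≤ Real.log n := Real.log_natCast_nonneg n
  have hD_nonneg : 0 ≤ D := by positivity
  have hcoef : 1 ≤ B * (1 + Real.log n) := by nlinarith
  calc cumulativeError (policy n σ β) θ (fun t => θ t + z t)
      ≤ (σ * √B) ^ 2 * (1 + Real.log n) +
          98 * (1 + Real.log n) * rate (σ * √B) (extendZero θ) 1 n + 4 * D := by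
        obtain ⟨m, rfl⟩ : ∃ m, n = m + 1 := ⟨n - 1, (Nat.succ_pred_eq_of_pos hn).symm⟩
        rw [cumulativeError_policy, hD, ← sum_range_sq_extendZero_sub θ hn]
        exact sum_sq_predict_sub_le hσ (le_mul_of_one_le_right hσ (Real.one_le_sqrt.mpr hβ))
          (extendZero_zero z) hz m.lt_succ_self
    _ ≤ σ ^ 2 * B * (1 + Real.log n) + 98 * (1 + Real.log n) * (B * R) + 4 * D := by
        rw [mul_pow, Real.sq_sqrt (zero_le_one.trans hβ)]
        gcongr
        exact rate_extendZero_le θ hσ hβ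
    _ ≤ 98 * B * (1 + Real.log n) * (R + |θ ⟨0, hn⟩| ^ 2 + ∑ i, diff θ i ^ 2 + σ ^ 2) := by
        rw [add_assoc R, ← hD]
        nlinarith [mul_le_mul_of_nonneg_right hcoef hD_nonneg,
          mul_nonneg (zero_le_one.trans hcoef) (sq_nonneg σ)]

end Policy

section Probability

variable {Ω : Type*} [MeasurableSpace Ω] {P : Measure Ω}

theorem hasSubgaussianMGF_mono {X : Ω → ℝ} {c d : ℝ≥0} (h : HasSubgaussianMGF X c P)
    (hcd : c ≤ d) : HasSubgaussianMGF X d P where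
  integrable_exp_mul := h.integrable_exp_mul
  mgf_le t := (h.mgf_le t).trans <| by
    have : (c : ℝ) ≤ d := hcd
    gcongr

theorem sum_sq_le_one_of_sq_le_sum_sq {ι : Type*} [Fintype ι] {w : ι → ℝ}
    (h : ∀ x : ι → ℝ, (∑ i, w i * x i) ^ 2 ≤ ∑ i, x i ^ 2) : ∑ i, w i ^ 2 ≤ 1 := by
  have hw := h w
  simp only [← sq] at hw
  by_contra! hlt
  nlinarith

theorem hasSubgaussianMGF_of_isLinearMap {ι : Type*} [Fintype ι] {c : ℝ≥0} {Z : ι → Ω → ℝ}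
    (hind : iIndepFun Z P) (hsub : ∀ i, HasSubgaussianMGF (Z i) c P) {f : (ι → ℝ) → ℝ}
    (hf : IsLinearMap ℝ f) (hf_le : ∀ x, f x ^ 2 ≤ ∑ i, x i ^ 2) :
    HasSubgaussianMGF (fun ω => f fun i => Z i ω) c P := by
  classical
  set w : ι → ℝ := fun i => f (Pi.single i 1)
  have hfw : ∀ x, f x = ∑ i, w i * x i := fun x => by
    conv_lhs => rw [← hf.mk'_apply, (hf.mk' f).pi_apply_eq_sum_univ x]
    simp only [smul_eq_mul, mul_comm (x _), hf.mk'_apply, w]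
    refine Finset.sum_congr rfl fun i _ => ?_
    congr 2
    funext j
    simp [Pi.single_apply, eq_comm]
  have hw : ∑ i, w i ^ 2 ≤ 1 := sum_sq_le_one_of_sq_le_sum_sq fun x => hfw x ▸ hf_le x
  have hparam : ∑ i, NNReal.mk (w i ^ 2) (sq_nonneg _) * c ≤ c := by
    rw [← Finset.sum_mul]
    refine mul_le_of_le_one_left zero_le ?_
    rw [← NNReal.coe_le_coe]
    push_cast
    exact hw
  simp only [hfw]
  exact hasSubgaussianMGF_mono (HasSubgaussianMGF.sum_of_iIndepFun
    (hind.comp (fun i x => w i * x) fun i => measurable_const_mul _)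
    (s := Finset.univ) fun i _ => (hsub i).const_mul (w i)) hparam

theorem measureReal_lt_abs_le [IsProbabilityMeasure P] {X : Ω → ℝ} {σ : ℝ≥0}
    (h : HasSubgaussianMGF X (σ ^ 2) P) {r : ℝ} (hr : 0 ≤ r) :
    P.real {ω | (σ : ℝ) * r < |X ω|} ≤ 2 * Real.exp (-r ^ 2 / 2) := by
  rcases eq_or_ne σ 0 with rfl | hσ
  · rw [zero_pow two_ne_zero] at h
    have hnull : P.real {ω | ((0 : ℝ≥0) : ℝ) * r < |X ω|} = 0 := by
      rw [measureReal_eq_zero_iff]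
      refine measure_mono_null (fun ω hω => ?_) (ae_iff.mp h.ae_eq_zero_of_hasSubgaussianMGF_zero)
      simpa using hω
    rw [hnull]
    positivity
  · have hσr : 0 ≤ (σ : ℝ) * r := mul_nonneg σ.coe_nonneg hr
    have hexp : -((σ : ℝ) * r) ^ 2 / (2 * ((σ ^ 2 : ℝ≥0) : ℝ)) = -r ^ 2 / 2 := by
      push_cast
      field_simp
    calc P.real {ω | (σ : ℝ) * r < |X ω|}
        ≤ P.real ({ω | (σ : ℝ) * r ≤ X ω} ∪ {ω | (σ : ℝ) * r ≤ (-X) ω}) :=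
          measureReal_mono fun ω (hω : σ * r < |X ω|) =>
            (lt_abs.mp hω).imp (fun h => h.le) fun h => h.le
      _ ≤ P.real {ω | (σ : ℝ) * r ≤ X ω} + P.real {ω | (σ : ℝ) * r ≤ (-X) ω} :=
          measureReal_union_le _ _
      _ ≤ Real.exp (-r ^ 2 / 2) + Real.exp (-r ^ 2 / 2) :=
          add_le_add (hexp ▸ h.measure_ge_le hσr) (hexp ▸ h.neg.measure_ge_le hσr)
      _ = 2 * Real.exp (-r ^ 2 / 2) := (two_mul _).symm

theorem ofReal_one_sub_le_measure [IsProbabilityMeasure P] {p q : Ω → Prop} {δ : ℝ}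
    (hδ : P.real {ω | ¬ p ω} ≤ δ) (hpq : ∀ ω, p ω → q ω) :
    ENNReal.ofReal (1 - δ) ≤ P {ω | q ω} := by
  have hcompl : P.real {ω | ¬ q ω} ≤ δ :=
    (measureReal_mono fun ω hω => mt (hpq ω) hω).trans hδ
  have hcover : 1 ≤ P.real {ω | q ω} + P.real {ω | ¬ q ω} :=
    calc 1 = P.real ({ω | q ω} ∪ {ω | ¬ q ω}) := by
          rw [← probReal_univ (μ := P), ← Set.union_compl_self {ω | q ω}]
          rfl
      _ ≤ P.real {ω | q ω} + P.real {ω | ¬ q ω} := measureReal_union_le _ _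
  rw [← ofReal_measureReal]
  exact ENNReal.ofReal_le_ofReal (by linarith)

end Probability

section Concentration

theorem sum_sq_extendZero_le {n : ℕ} (z : Fin n → ℝ) {a t : ℕ} (ha : 1 ≤ a) (ht : t ≤ n) :
    ∑ s ∈ Finset.Icc a t, extendZero z s ^ 2 ≤ ∑ i, z i ^ 2 := by
  have hsum : ∑ s ∈ Finset.Icc 1 n, extendZero z s ^ 2 = ∑ i, z i ^ 2 := by
    rw [← Finset.Ico_add_one_right_eq_Icc, Finset.sum_Ico_eq_sum_range, Nat.add_sub_cancel,
      Finset.sum_range]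
    refine Finset.sum_congr rfl fun i _ => ?_
    rw [add_comm 1, extendZero_succ]
  rw [← hsum]
  exact Finset.sum_le_sum_of_subset_of_nonneg (Finset.Icc_subset_Icc ha ht)
    fun _ _ _ => sq_nonneg _

theorem sq_segmentCoeff_le (y : ℕ → ℝ) {a t l i : ℕ} (hl : l < padExp a t) (hi : i < 2 ^ l) :
    segmentCoeff y a t l i ^ 2 ≤ ∑ s ∈ Finset.Icc a t, y s ^ 2 :=
  calc segmentCoeff y a t l i ^ 2
      ≤ ∑ i ∈ Finset.range (2 ^ l), segmentCoeff y a t l i ^ 2 :=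
        Finset.single_le_sum (f := fun i => segmentCoeff y a t l i ^ 2)
          (fun _ _ => sq_nonneg _) (Finset.mem_range.mpr hi)
    _ ≤ ∑ l ∈ Finset.range (padExp a t), ∑ i ∈ Finset.range (2 ^ l), segmentCoeff y a t l i ^ 2 :=
        Finset.single_le_sum
          (f := fun l => ∑ i ∈ Finset.range (2 ^ l), segmentCoeff y a t l i ^ 2)
          (fun _ _ => Finset.sum_nonneg fun _ _ => sq_nonneg _) (Finset.mem_range.mpr hl)
    _ = scatter y a t := sum_segmentCoeff_sq y a t
    _ ≤ ∑ s ∈ Finset.Icc a t, y s ^ 2 := by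
        rw [← scatter_add_length_mul_sq_mean]
        exact le_add_of_nonneg_right (by positivity)

theorem sq_sqrt_length_mul_mean_le (y : ℕ → ℝ) (a t : ℕ) :
    (√((t + 1 - a : ℕ) : ℝ) * mean y a t) ^ 2 ≤ ∑ s ∈ Finset.Icc a t, y s ^ 2 := by
  rw [← scatter_add_length_mul_sq_mean, mul_pow, Real.sq_sqrt (Nat.cast_nonneg _)]
  exact le_add_of_nonneg_left (scatter_nonneg y a t)

variable {Ω : Type*} [MeasurableSpace Ω] {P : Measure Ω} [IsProbabilityMeasure P]
  {n : ℕ} {σ : ℝ≥0} {Z : Fin n → Ω → ℝ} {r : ℝ} {a t : ℕ}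

theorem measureReal_lt_abs_extendZero_le (hind : iIndepFun Z P)
    (hsub : ∀ i, HasSubgaussianMGF (Z i) (σ ^ 2) P) (hr : 0 ≤ r) (ha : 1 ≤ a) (ht : t ≤ n)
    {f : (ℕ → ℝ) → ℝ} (hf : IsLinearMap ℝ f)
    (hf_le : ∀ y, f y ^ 2 ≤ ∑ s ∈ Finset.Icc a t, y s ^ 2) :
    P.real {ω | (σ : ℝ) * r < |f (extendZero fun i => Z i ω)|} ≤ 2 * Real.exp (-r ^ 2 / 2) :=
  measureReal_lt_abs_le (hasSubgaussianMGF_of_isLinearMap hind hsub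
    (hf.mk' f ∘ₗ isLinearMap_extendZero.mk' extendZero).isLinear
    fun z => (hf_le _).trans (sum_sq_extendZero_le z ha ht)) hr

theorem measureReal_not_segmentNoiseBound_le (hind : iIndepFun Z P)
    (hsub : ∀ i, HasSubgaussianMGF (Z i) (σ ^ 2) P) (hr : 0 ≤ r) (ha : 1 ≤ a) (hat : a ≤ t)
    (ht : t ≤ n) :
    P.real {ω | ¬ SegmentNoiseBound (σ * r) (extendZero fun i => Z i ω) a t} ≤
      4 * n * Real.exp (-r ^ 2 / 2) := by
  set ε := 2 * Real.exp (-r ^ 2 / 2) with hε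
  set I := (Finset.range (padExp a t)).sigma fun l => Finset.range (2 ^ l)
  have hcard : (I.card : ℝ) + 1 ≤ 2 * n := by
    have hgeom : I.card + 1 = 2 ^ padExp a t := by
      rw [Finset.card_sigma]
      simp only [Finset.card_range]
      simpa using geom_sum_mul_add (1 : ℕ) (padExp a t)
    have := two_pow_padExp_le hat
    exact_mod_cast (by omega : I.card + 1 ≤ 2 * n)
  calc P.real {ω | ¬ SegmentNoiseBound (σ * r) (extendZero fun i => Z i ω) a t}
      ≤ P.real ((⋃ q ∈ I, {ω | (σ : ℝ) * r <
            |segmentCoeff (extendZero fun i => Z i ω) a t q.1 q.2|}) ∪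
          {ω | (σ : ℝ) * r <
            |√((t + 1 - a : ℕ) : ℝ) * mean (extendZero fun i => Z i ω) a t|}) := by
        refine measureReal_mono fun ω hω => ?_
        by_contra hgood
        simp only [Set.mem_union, Set.mem_iUnion, Set.mem_ofPred_eq, not_or, not_exists, not_lt]
          at hgood
        refine hω ⟨fun l hl i hi => hgood.1 ⟨l, i⟩ ?_, ?_⟩
        · exact Finset.mem_sigma.mpr ⟨Finset.mem_range.mpr hl, Finset.mem_range.mpr hi⟩
        · simpa only [abs_mul, abs_of_nonneg (Real.sqrt_nonneg _)] using hgood.2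
    _ ≤ I.card * ε + ε := by
        refine (measureReal_union_le _ _).trans (add_le_add ?_ ?_)
        · rw [← nsmul_eq_mul]
          refine (measureReal_biUnion_finset_le _ _).trans
            (Finset.sum_le_card_nsmul _ _ _ fun q hq => ?_)
          simp only [I, Finset.mem_sigma, Finset.mem_range] at hq
          exact measureReal_lt_abs_extendZero_le hind hsub hr ha ht
            (isLinearMap_segmentCoeff a t q.1 q.2) fun y => sq_segmentCoeff_le y hq.1 hq.2
        · exact measureReal_lt_abs_extendZero_le hind hsub hr ha ht
            ((√((t + 1 - a : ℕ) : ℝ)) • (isLinearMap_mean a t).mk' _).isLinear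
            fun y => sq_sqrt_length_mul_mean_le y a t
    _ = (I.card + 1) * ε := by ring
    _ ≤ 2 * n * ε := by gcongr
    _ = 4 * n * Real.exp (-r ^ 2 / 2) := by rw [hε]; ring

theorem measureReal_not_noiseBound_le (hind : iIndepFun Z P)
    (hsub : ∀ i, HasSubgaussianMGF (Z i) (σ ^ 2) P) (hr : 0 ≤ r) :
    P.real {ω | ¬ NoiseBound n (σ * r) (extendZero fun i => Z i ω)} ≤
      4 * n ^ 3 * Real.exp (-r ^ 2 / 2) := by
  set segments := (Finset.Icc 1 n ×ˢ Finset.Icc 1 n).filter fun q => q.1 ≤ q.2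
  have hmem : ∀ a t, (a, t) ∈ segments ↔ (1 ≤ a ∧ a ≤ t ∧ t ≤ n) := fun a t => by
    simp only [segments, Finset.mem_filter, Finset.mem_product, Finset.mem_Icc]
    omega
  have hcard : (segments.card : ℝ) ≤ n ^ 2 := by
    have := (Finset.Icc 1 n ×ˢ Finset.Icc 1 n).card_filter_le fun q => q.1 ≤ q.2
    rw [Finset.card_product, Nat.card_Icc, Nat.add_sub_cancel, ← sq] at this
    exact_mod_cast this
  calc P.real {ω | ¬ NoiseBound n (σ * r) (extendZero fun i => Z i ω)}
      ≤ P.real (⋃ q ∈ segments,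
          {ω | ¬ SegmentNoiseBound (σ * r) (extendZero fun i => Z i ω) q.1 q.2}) := by
        refine measureReal_mono (fun ω hω => ?_) (measure_ne_top P _)
        by_contra hgood
        simp only [Set.mem_iUnion, Set.mem_ofPred_eq, not_exists, not_not] at hgood
        exact hω fun a t ha hat ht => hgood (a, t) ((hmem a t).mpr ⟨ha, hat, ht⟩)
    _ ≤ segments.card • (4 * n * Real.exp (-r ^ 2 / 2)) := by
        refine (measureReal_biUnion_finset_le _ _).trans
          (Finset.sum_le_card_nsmul _ _ _ fun ⟨a, t⟩ hq => ?_)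
        obtain ⟨ha, hat, ht⟩ := (hmem a t).mp hq
        exact measureReal_not_segmentNoiseBound_le hind hsub hr ha hat ht
    _ ≤ n ^ 2 * (4 * n * Real.exp (-r ^ 2 / 2)) := by
        rw [nsmul_eq_mul]
        gcongr
    _ = 4 * n ^ 3 * Real.exp (-r ^ 2 / 2) := by ring

end Concentration

section Tuning

/-- The hyper-parameter `β` of the policy for which its error bound holds with probability at
least `1 - δ`. -/
def tuning (n : ℕ) (δ : ℝ) : ℝ := 24 + 8 * Real.log (8 / δ) / Real.log n

variable {n : ℕ} {δ : ℝ}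

theorem tuning_mul_log (hn : 2 ≤ n) (δ : ℝ) :
    tuning n δ * Real.log n = 24 * Real.log n + 8 * Real.log (8 / δ) := by
  have hlog : Real.log n ≠ 0 := (Real.log_pos (by exact_mod_cast hn)).ne'
  rw [tuning, add_mul, div_mul_cancel₀ _ hlog]

theorem log_eight_div (hδ : 0 < δ) : Real.log (8 / δ) = 3 * Real.log 2 + Real.log (1 / δ) := by
  rw [← mul_one_div, Real.log_mul (by norm_num) (by positivity),
    show (8 : ℝ) = 2 ^ 3 by norm_num, Real.log_pow, Nat.cast_ofNat]

theorem one_le_tuning_mul_log (hn : 2 ≤ n) (hδ₀ : 0 < δ) (hδ₁ : δ ≤ 1) :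
    1 ≤ tuning n δ * Real.log n := by
  rw [tuning_mul_log hn, log_eight_div hδ₀]
  linarith [Real.log_two_gt_d9, Real.log_natCast_nonneg n,
    Real.log_nonneg ((one_le_div hδ₀).mpr hδ₁)]

theorem tuning_mul_log_mul_le (hn : 2 ≤ n) (hδ₀ : 0 < δ) (hδ₁ : δ ≤ 1) :
    tuning n δ * Real.log n * (1 + Real.log n) ≤ 24 * (1 + Real.log n + Real.log (1 / δ)) ^ 2 := by
  have : 0 ≤ Real.log n := Real.log_natCast_nonneg n
  have hlogδ : 0 ≤ Real.log (1 / δ) := Real.log_nonneg ((one_le_div hδ₀).mpr hδ₁)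
  have htuning : tuning n δ * Real.log n ≤ 24 * (1 + Real.log n + Real.log (1 / δ)) := by
    rw [tuning_mul_log hn, log_eight_div hδ₀]
    linarith [Real.log_two_lt_d9]
  calc tuning n δ * Real.log n * (1 + Real.log n)
      ≤ 24 * (1 + Real.log n + Real.log (1 / δ)) * (1 + Real.log n + Real.log (1 / δ)) :=
        mul_le_mul htuning (le_add_of_nonneg_right hlogδ) (by positivity) (by positivity)
    _ = 24 * (1 + Real.log n + Real.log (1 / δ)) ^ 2 := by ring

theorem four_mul_pow_mul_exp_tuning_le (hn : 2 ≤ n) (hδ₀ : 0 < δ) (hδ₁ : δ ≤ 1) :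
    4 * (n : ℝ) ^ 3 * Real.exp (-(√(tuning n δ * Real.log n) / 2) ^ 2 / 2) ≤ δ := by
  have : (0 : ℝ) < n := by positivity
  have hexponent : -(√(tuning n δ * Real.log n) / 2) ^ 2 / 2 =
      -((3 : ℕ) * Real.log n) + -Real.log (8 / δ) := by
    rw [div_pow, Real.sq_sqrt (zero_le_one.trans (one_le_tuning_mul_log hn hδ₀ hδ₁)),
      tuning_mul_log hn]
    push_cast
    ring
  rw [hexponent, Real.exp_add, ← Real.log_pow, ← Real.log_inv, ← Real.log_inv,
    Real.exp_log (by positivity), Real.exp_log (by positivity)]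
  field_simp
  linarith

theorem measureReal_not_noiseBound_tuning_le {Ω : Type*} [MeasurableSpace Ω] {P : Measure Ω}
    [IsProbabilityMeasure P] {σ : ℝ≥0} {Z : Fin n → Ω → ℝ} (hn : 2 ≤ n) (hδ₀ : 0 < δ)
    (hδ₁ : δ ≤ 1) (hind : iIndepFun Z P) (hsub : ∀ t, HasSubgaussianMGF (Z t) (σ ^ 2) P) :
    P.real {ω | ¬ NoiseBound n (σ * √(tuning n δ * Real.log n) / 2)
      (extendZero fun t => Z t ω)} ≤ δ := by
  simp only [mul_div_assoc (σ : ℝ)]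
  exact (measureReal_not_noiseBound_le hind hsub (by positivity)).trans
    (four_mul_pow_mul_exp_tuning_le hn hδ₀ hδ₁)

end Tuning

end Arrows

end

theorem theorem1 :
    ∃ C : ℝ, 0 < C ∧ ∃ k : ℕ,
      ∀ (n : ℕ) (hn : 2 ≤ n) (δ : ℝ), 0 < δ → δ ≤ 1 →
      ∀ (σ : ℝ≥0) (θ : Fin n → ℝ)
        (Ω : Type*) [MeasurableSpace Ω] (P : Measure Ω) [IsProbabilityMeasure P]
        (Z : Fin n → Ω → ℝ),
        (∀ t, Measurable (Z t)) →
        iIndepFun Z P →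
        (∀ t, HasSubgaussianMGF (Z t) (σ ^ 2) P) →
        ENNReal.ofReal (1 - δ) ≤
          P {ω | Arrows.cumulativeError
                (Arrows.policy n σ (24 + 8 * Real.log (8 / δ) / Real.log n))
                θ (fun t => θ t + Z t ω) ≤
              C * (1 + Real.log n + Real.log (1 / δ)) ^ k *
                ((n : ℝ) ^ (1 / 3 : ℝ) * (∑ i, |Arrows.diff θ i|) ^ (2 / 3 : ℝ)
                    * (σ : ℝ) ^ (4 / 3 : ℝ)
                  + |θ ⟨0, by omega⟩| ^ 2 + ∑ i, Arrows.diff θ i ^ 2 + (σ : ℝ) ^ 2)} := by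
  refine ⟨2352, by norm_num, 2, ?_⟩
  intro n hn δ hδ₀ hδ₁ σ θ Ω _ P _ Z _ hind hsub
  refine Arrows.ofReal_one_sub_le_measure
    (Arrows.measureReal_not_noiseBound_tuning_le hn hδ₀ hδ₁ hind hsub) fun ω hω => ?_
  refine (Arrows.cumulativeError_policy_le θ _ (two_pos.trans_le hn) σ.coe_nonneg
    (Arrows.one_le_tuning_mul_log hn hδ₀ hδ₁) hω).trans ?_
  refine mul_le_mul_of_nonneg_right ?_ (by positivity)
  linarith [Arrows.tuning_mul_log_mul_le hn hδ₀ hδ₁]
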